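/- **Theorem.** Consider walks in $\mathbb Z^2$ that start at $(0,0)$, take steps in $\{\mathrm{NE}=(1,1),\ \mathrm{SE}=(1,-1),\ \mathrm{W}=(-1,0)\}$ and stay in the quadrant $\{x\ge 0,\ y\ge 0\}$. Let $Q_9(x,y;t)\in\mathbb Q[x,y][[t]]$ be the series in which the coefficient of $x^iy^jt^n$ is the number of such walks of length $n$ ending at $(i,j)$, and let $R(y,t)=Q_9(0,y;t)$ be the generating series of those walks that end on the $y$-axis. (1) Let $S(y,t)\in\mathbb Q[y][[t]]$ be the series whose non-zero coefficients are $$[y^{n-2k}t^{2n-1}]\,S(y,t)=\frac1n\binom nk\binom{2n-2}{n-1},\qquad n\ge 1,\quad 0\le k\le n/2 .$$ Then $$t\,y\,R(y,t)=\left(\frac{(y^2-1)\,S(y,t)}{y^2+1}\right)^{\ge},$$ where, for each power of $t$, the coefficient of the fraction is expanded as a Laurent series in $y^{-1}$, i.e. in $\mathbb Q((y^{-1}))$, and $F^{\ge}$ denotes the sub-series of $F$ formed by the terms with non-negative powers of $y$. (2) There is a unique series $$T=T(x,t)=\frac{(x-t)-\sqrt{(x-t)^2-4t^2x^4}}{2tx^2}\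 \in\ \mathbb Q[x,x^{-1}][[t]],$$ where the square root is the one equal to $x$ at $t=0$, and the complete generating series is $$Q_9(x,y;t)=\frac{xy-T\,\bigl(x-t\,R(T,t)\bigr)-t\,y\,R(y,t)}{xy-t\,x^2(y^2+1)-t\,y},$$ an identity of quotients in the field of fractions of the domain $\mathbb Q[x,x^{-1},y][[t]]$, where $R(T,t)$ is the series obtained from $R(y,t)$ by substituting $y=T$. -/

import Mathlib

open scoped PowerSeries LaurentPolynomial

/-- Words of length `n` over the step set `Y` all of whose prefixes end in the first quadrant and
that end at the point `(i, j)`. -/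
def quadrantWalks (Y : Finset (ℤ × ℤ)) (n i j : ℕ) : Set (List (ℤ × ℤ)) :=
  {w | w.length = n ∧ (∀ s ∈ w, s ∈ Y) ∧
    (∀ p : List (ℤ × ℤ), p <+: w → 0 ≤ p.sum.1 ∧ 0 ≤ p.sum.2) ∧
    w.sum = ((i : ℤ), (j : ℤ))}

/-- The step set `{NE, SE, W}`. -/
def stepsNESEW : Finset (ℤ × ℤ) := {(1, 1), (1, -1), (-1, 0)}

/-- The complete generating series `Q(x, y; t)` of the quadrant walks with steps in
`{NE, SE, W}`, as an element of `ℚ[x][y]⟦t⟧`. A walk of length `n` ends at some `(i, j)` with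
`i, j ≤ n`, so the inner sums run over all possible end points. -/
noncomputable def completeGF : PowerSeries (Polynomial (Polynomial ℚ)) :=
  PowerSeries.mk fun n =>
    ∑ i ∈ Finset.range (n + 1), ∑ j ∈ Finset.range (n + 1),
      Polynomial.monomial j
        (Polynomial.monomial i ((quadrantWalks stepsNESEW n i j).ncard : ℚ))

/-- The series `R(y, t) = Q(0, y; t)`, in `ℚ[y]⟦t⟧`: `x` is set to zero. -/
noncomputable def returnGF : PowerSeries (Polynomial ℚ) :=
  PowerSeries.map (Polynomial.mapRingHom (Polynomial.evalRingHom (0 : ℚ))) completeGF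

/-- The series `S(y, t)` in `ℚ[y]⟦t⟧`: its coefficient of `t ^ (2 n - 1)`, for `n ≥ 1`, is the
sum over `0 ≤ k ≤ n / 2` of `(n choose k) * (2 n - 2 choose n - 1) / n * y ^ (n - 2 k)`.
The exponent `N = 2 n - 1` determines `n = (N + 1) / 2`. -/
noncomputable def seriesS : PowerSeries (Polynomial ℚ) :=
  PowerSeries.mk fun N =>
    if Odd N then
      ∑ k ∈ Finset.range ((N + 1) / 2 / 2 + 1),
        Polynomial.monomial ((N + 1) / 2 - 2 * k)
          ((((N + 1) / 2).choose k : ℚ) *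
            ((2 * ((N + 1) / 2) - 2).choose ((N + 1) / 2 - 1) : ℚ) / (((N + 1) / 2 : ℕ) : ℚ))
    else 0

/-- The element `y` of the field `ℚ((y⁻¹))`. The Laurent series variable is `y⁻¹`, so that `y` is
the monomial of exponent `-1`, and the coefficient of `y ^ j` is the coefficient at `-j`. -/
noncomputable def yElem : LaurentSeries ℚ := HahnSeries.single (-1 : ℤ) (1 : ℚ)

/-- The series `(y ^ 2 - 1) * S(y, t) / (y ^ 2 + 1)` in `ℚ((y⁻¹))⟦t⟧`, that is, every coefficient
(in `t`) is expanded in descending powers of `y`. -/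
noncomputable def quotientSeries : PowerSeries (LaurentSeries ℚ) :=
  PowerSeries.C ((yElem ^ 2 - 1) / (yElem ^ 2 + 1)) *
    PowerSeries.map (Polynomial.aeval (R := ℚ) yElem).toRingHom seriesS

/-- `T = ((x - t) - √((x - t)² - 4 t² x⁴)) / (2 t x²)` in `ℚ[x, x⁻¹]⟦t⟧`, where the square root
`D` is the one whose value at `t = 0` is `x`. -/
def IsKernelRoot (T : PowerSeries ℚ[T;T⁻¹]) : Prop :=
  let x : PowerSeries ℚ[T;T⁻¹] := PowerSeries.C (LaurentPolynomial.T 1)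
  let t : PowerSeries ℚ[T;T⁻¹] := PowerSeries.X
  ∃ D : PowerSeries ℚ[T;T⁻¹],
    PowerSeries.constantCoeff D = LaurentPolynomial.T 1 ∧
    D ^ 2 = (x - t) ^ 2 - 4 * t ^ 2 * x ^ 4 ∧
    2 * t * x ^ 2 * T = (x - t) - D

/-- Substitution `F(U, t)` of `y = U(t)` in `F(y, t) = ∑ fₘ(y) tᵐ`: the series
`∑ fₘ(U) tᵐ`, whose coefficient of `t ^ N` only involves `fₘ` for `m ≤ N`. -/
noncomputable def substY (F : PowerSeries (Polynomial ℚ)) (U : PowerSeries ℚ[T;T⁻¹]) :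
    PowerSeries ℚ[T;T⁻¹] :=
  PowerSeries.mk fun N =>
    ∑ m ∈ Finset.range (N + 1),
      PowerSeries.coeff (N - m) (Polynomial.aeval U (PowerSeries.coeff m F))

/-- The inclusion `ℚ[x][y]⟦t⟧ → ℚ[x, x⁻¹][y]⟦t⟧`. -/
noncomputable def inclXY :
    PowerSeries (Polynomial (Polynomial ℚ)) →+* PowerSeries (Polynomial ℚ[T;T⁻¹]) :=
  PowerSeries.map (Polynomial.mapRingHom (Polynomial.toLaurentAlg (R := ℚ)).toRingHom)

/-- The inclusion `ℚ[y]⟦t⟧ → ℚ[x, x⁻¹][y]⟦t⟧`. -/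
noncomputable def inclY :
    PowerSeries (Polynomial ℚ) →+* PowerSeries (Polynomial ℚ[T;T⁻¹]) :=
  PowerSeries.map (Polynomial.mapRingHom (algebraMap ℚ ℚ[T;T⁻¹]))

/-- The inclusion `ℚ[x, x⁻¹]⟦t⟧ → ℚ[x, x⁻¹][y]⟦t⟧`. -/
noncomputable def inclX :
    PowerSeries ℚ[T;T⁻¹] →+* PowerSeries (Polynomial ℚ[T;T⁻¹]) :=
  PowerSeries.map Polynomial.C

/-! Part (1) rests on a product formula, `walkCount_eq`. The abscissa follows a nonnegative `±1`
path, and each of its up-steps carries one step of a second nonnegative `±1` path, the ordinate. A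
walk of length `n` ending at abscissa `i` has `(n + i) / 2` up-steps, so the count is a product of
two ballot numbers, given by reflection. For `i = 0` and `n = 2m` the first factor is a Catalan
number.

On the other side, the coefficient of `t ^ (2m + 1)` in `S` is the same Catalan number times the
part of `(y + y⁻¹) ^ (m + 1)` with non-negative powers of `y`. Since `(y² - 1) / (y² + 1) = (y -
y⁻¹) / (y + y⁻¹)`, multiplying the full power by it gives `(y - y⁻¹) (y + y⁻¹) ^ m`, whose
coefficients are the reflection differences. The ratio is a power series in `y⁻¹`, so the discarded
tail affects only negative powers of `y` (`coeff_quotientSeries_odd`).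

Part (2) is the kernel method: `T` is the power series root in `y` of the kernel. Substituting `y =
T` in the last-step functional equation expresses `Q(x, 0; t)` through `R(T, t)`
(`IsKernelRoot.axisGF_eq`), and this is put back in the equation. -/

/-! ### Simple paths and the reflection principle -/

/-- The number of sequences of `n` signs `±1` with sum `j`. -/
def signCount : ℕ → ℤ → ℚ
  | 0, j => if j = 0 then 1 else 0
  | n + 1, j => signCount n (j - 1) + signCount n (j + 1)

/-- The number of `±1` paths of length `n` from `0` to `j` that stay nonnegative, in the form
given by the reflection principle. -/
def ballotCount (n : ℕ) (j : ℤ) : ℚ := signCount n j - signCount n (j + 2)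

theorem signCount_neg (n : ℕ) (j : ℤ) : signCount n (-j) = signCount n j := by
  induction n generalizing j with
  | zero => simp [signCount]
  | succ n ih =>
    simp only [signCount]
    rw [show -j - 1 = -(j + 1) by ring, show -j + 1 = -(j - 1) by ring, ih, ih, add_comm]

theorem signCount_eq_zero_of_lt {n : ℕ} {j : ℤ} (h : (n : ℤ) < j) : signCount n j = 0 := by
  induction n generalizing j with
  | zero => simp [signCount]; omega
  | succ n ih =>
    push_cast at h
    simp only [signCount]
    rw [ih (by omega), ih (by omega), add_zero]

theorem signCount_eq_zero_of_odd {n : ℕ} {j : ℤ} (h : ((n : ℤ) + j) % 2 = 1) :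
    signCount n j = 0 := by
  induction n generalizing j with
  | zero => simp [signCount]; omega
  | succ n ih =>
    push_cast at h
    simp only [signCount]
    rw [ih (by omega), ih (by omega), add_zero]

theorem signCount_sub_two_mul (n k : ℕ) : signCount n (n - 2 * k) = n.choose k := by
  induction n generalizing k with
  | zero => cases k with
    | zero => simp [signCount]
    | succ k => simp [signCount]; omega
  | succ n ih =>
    simp only [signCount]
    rw [show ((n + 1 : ℕ) : ℤ) - 2 * (k : ℤ) - 1 = n - 2 * k by push_cast; ring, ih]
    cases k with
    | zero => rw [signCount_eq_zero_of_lt (by push_cast; omega)]; simp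
    | succ k =>
      rw [show ((n + 1 : ℕ) : ℤ) - 2 * ((k + 1 : ℕ) : ℤ) + 1 = n - 2 * k by push_cast; ring, ih,
        Nat.choose_succ_succ]
      push_cast; ring

theorem ballotCount_succ (n : ℕ) (j : ℤ) :
    ballotCount (n + 1) j = ballotCount n (j - 1) + ballotCount n (j + 1) := by
  simp only [ballotCount, signCount]
  ring_nf

theorem ballotCount_neg_one (n : ℕ) : ballotCount n (-1) = 0 := by
  simp [ballotCount, signCount_neg]

theorem ballotCount_zero_left {j : ℤ} (h : -1 ≤ j) :
    ballotCount 0 j = if j = 0 then 1 else 0 := by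
  rw [ballotCount]
  simp only [signCount]
  rw [if_neg (show ¬ j + 2 = 0 by omega), sub_zero]

theorem ballotCount_eq_zero_of_lt {n : ℕ} {j : ℤ} (h : (n : ℤ) < j) : ballotCount n j = 0 := by
  rw [ballotCount, signCount_eq_zero_of_lt h, signCount_eq_zero_of_lt (by omega), sub_zero]

theorem ballotCount_eq_zero_of_odd {n : ℕ} {j : ℤ} (h : ((n : ℤ) + j) % 2 = 1) :
    ballotCount n j = 0 := by
  rw [ballotCount, signCount_eq_zero_of_odd h, signCount_eq_zero_of_odd (by omega), sub_zero]

theorem ballotCount_two_mul_zero (m : ℕ) :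
    ballotCount (2 * m) 0 = ((2 * m).choose m : ℚ) / ((m + 1 : ℕ) : ℚ) := by
  have h1 := signCount_sub_two_mul (2 * m) m
  have h2 := signCount_sub_two_mul (2 * m) (m + 1)
  rw [show ((2 * m : ℕ) : ℤ) - 2 * (m : ℤ) = 0 by push_cast; ring] at h1
  rw [show ((2 * m : ℕ) : ℤ) - 2 * ((m + 1 : ℕ) : ℤ) = -(0 + 2) by push_cast; ring,
    signCount_neg] at h2
  rw [ballotCount, h1, h2, eq_div_iff (by positivity)]
  have h3 := Nat.choose_succ_right_eq (2 * m) m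
  rw [show 2 * m - m = m by omega] at h3
  have h4 : ((2 * m).choose (m + 1) : ℚ) * (m + 1) = (2 * m).choose m * m := by exact_mod_cast h3
  push_cast
  linear_combination -h4

/-! ### Quadrant walks: last-step recurrence and product formula -/

/-- Words of length `n` over `Y` whose prefixes all end in the first quadrant, ending at `p`. -/
def quadrantWords (Y : Finset (ℤ × ℤ)) (n : ℕ) (p : ℤ × ℤ) : Set (List (ℤ × ℤ)) :=
  {w | w.length = n ∧ (∀ s ∈ w, s ∈ Y) ∧
    (∀ p : List (ℤ × ℤ), p <+: w → 0 ≤ p.sum.1 ∧ 0 ≤ p.sum.2) ∧ w.sum = p}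

theorem quadrantWords_finite (Y : Finset (ℤ × ℤ)) (n : ℕ) (p : ℤ × ℤ) :
    (quadrantWords Y n p).Finite := by
  have h : {l : List Y | l.length = n}.Finite := List.finite_length_eq Y n
  refine (h.image (List.map Subtype.val)).subset ?_
  rintro w ⟨hl, hY, -, -⟩
  refine ⟨w.attachWith (· ∈ Y) hY, by simpa using hl, ?_⟩
  simp [List.attach_map_subtype_val]

theorem quadrantWords_eq_empty (Y : Finset (ℤ × ℤ)) (n : ℕ) {p : ℤ × ℤ}
    (h : p.1 < 0 ∨ p.2 < 0) : quadrantWords Y n p = ∅ := by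
  refine Set.eq_empty_of_forall_notMem ?_
  rintro w ⟨-, -, hp, hs⟩
  have := hp w List.prefix_rfl
  rw [hs] at this
  omega

/-- Removing the last step leaves a word whose prefixes are prefixes of the original; the only new
prefix is the whole word, which is where `h` enters. -/
theorem quadrantWords_succ (Y : Finset (ℤ × ℤ)) (n : ℕ) {p : ℤ × ℤ}
    (h : 0 ≤ p.1 ∧ 0 ≤ p.2) :
    quadrantWords Y (n + 1) p =
      ⋃ s ∈ (Y : Set (ℤ × ℤ)), (fun w => w ++ [s]) '' quadrantWords Y n (p - s) := by
  ext w
  simp only [Set.mem_iUnion, Set.mem_image, exists_prop]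
  constructor
  · rintro ⟨hl, hY, hp, hs⟩
    have hne : w ≠ [] := by rintro rfl; simp at hl
    obtain ⟨v, s, rfl⟩ : ∃ v s, w = v ++ [s] :=
      ⟨w.dropLast, w.getLast hne, (List.dropLast_append_getLast hne).symm⟩
    refine ⟨s, hY s (by simp), v, ⟨by simpa using hl, fun a ha => hY a (by simp [ha]),
      fun q hq => hp q (hq.trans (List.prefix_append _ _)), ?_⟩, rfl⟩
    rw [← hs]; simp
  · rintro ⟨s, hsY, v, ⟨hl, hY, hp, hs⟩, rfl⟩
    refine ⟨by simp [hl], ?_, ?_, by simp [hs]⟩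
    · intro a ha
      rcases List.mem_append.1 ha with ha | ha
      · exact hY a ha
      · rw [List.mem_singleton.1 ha]; exact hsY
    · intro q hq
      rcases List.prefix_concat_iff.1 hq with rfl | hq
      · simpa [hs] using h
      · exact hp q hq

theorem ncard_quadrantWords_succ (Y : Finset (ℤ × ℤ)) (n : ℕ) {p : ℤ × ℤ}
    (h : 0 ≤ p.1 ∧ 0 ≤ p.2) :
    (quadrantWords Y (n + 1) p).ncard = ∑ s ∈ Y, (quadrantWords Y n (p - s)).ncard := by
  rw [quadrantWords_succ Y n h]
  have := Set.Finite.ncard_biUnion (t := (Y : Set (ℤ × ℤ))) (Finset.finite_toSet Y)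
    (s := fun s => (fun w => w ++ [s]) '' quadrantWords Y n (p - s))
    (fun s _ => (quadrantWords_finite Y n _).image _) ?_
  · rw [this, finsum_mem_coe_finset]
    refine Finset.sum_congr rfl fun s _ => ?_
    exact Set.ncard_image_of_injective _ (fun a b hab => List.append_cancel_right hab)
  · intro s _ s' _ hne
    refine Set.disjoint_left.2 ?_
    rintro _ ⟨a, -, rfl⟩ ⟨b, -, hb⟩
    have := List.append_inj_right' hb rfl
    simp at this
    exact hne this.symm

theorem ncard_quadrantWords_zero (Y : Finset (ℤ × ℤ)) (p : ℤ × ℤ) :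
    (quadrantWords Y 0 p).ncard = if p = 0 then 1 else 0 := by
  split_ifs with h
  · subst h
    rw [Set.ncard_eq_one]
    refine ⟨[], ?_⟩
    ext w
    simp only [quadrantWords, Set.mem_ofPred_eq, List.length_eq_zero_iff, Set.mem_singleton_iff]
    refine ⟨fun h => h.1, ?_⟩
    rintro rfl
    simp
  · rw [Set.ncard_eq_zero (quadrantWords_finite Y 0 p)]
    refine Set.eq_empty_of_forall_notMem ?_
    rintro w ⟨hl, -, -, hs⟩
    rw [List.length_eq_zero_iff] at hl
    subst hl
    exact h hs.symm

/-- The number of quadrant walks with steps in `{NE, SE, W}` of length `n` ending at `(i, j)`. -/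
noncomputable def walkCount (n : ℕ) (i j : ℤ) : ℚ := (quadrantWords stepsNESEW n (i, j)).ncard

theorem walkCount_zero (i j : ℤ) : walkCount 0 i j = if i = 0 ∧ j = 0 then 1 else 0 := by
  rw [walkCount, ncard_quadrantWords_zero]
  simp [Prod.ext_iff]

theorem walkCount_eq_zero {n : ℕ} {i j : ℤ} (h : i < 0 ∨ j < 0) : walkCount n i j = 0 := by
  rw [walkCount, quadrantWords_eq_empty _ _ h]
  simp

theorem walkCount_succ (n : ℕ) {i j : ℤ} (hi : 0 ≤ i) (hj : 0 ≤ j) :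
    walkCount (n + 1) i j =
      walkCount n (i - 1) (j - 1) + walkCount n (i - 1) (j + 1) + walkCount n (i + 1) j := by
  simp only [walkCount]
  rw [ncard_quadrantWords_succ _ _ ⟨hi, hj⟩, stepsNESEW, Finset.sum_insert (by simp),
    Finset.sum_insert (by simp), Finset.sum_singleton]
  simp [add_assoc]

/-- The abscissa performs a nonnegative path, and the ordinate moves along another one exactly
when the abscissa increases. -/
theorem walkCount_eq (n : ℕ) {i j : ℤ} (hi : -1 ≤ i) (hj : -1 ≤ j) :
    walkCount n i j = ballotCount n i * ballotCount ((n + i) / 2).toNat j := by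
  induction n generalizing i j with
  | zero =>
    rw [walkCount_zero, ballotCount_zero_left hi]
    by_cases h : i = 0
    · subst h; simp [ballotCount_zero_left hj]
    · simp [h]
  | succ n ih =>
    -- On the lines `i = -1` and `j = -1` both sides vanish; including them lets the induction
    -- hypothesis cover every neighbour of a quadrant point.
    rcases hi.eq_or_lt with rfl | hi
    · rw [walkCount_eq_zero (by omega), ballotCount_neg_one, zero_mul]
    rcases hj.eq_or_lt with rfl | hj
    · rw [walkCount_eq_zero (by omega), ballotCount_neg_one, mul_zero]
    rw [walkCount_succ n (by omega) (by omega), ih (by omega) (by omega), ih (by omega) (by omega),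
      ih (by omega) (by omega)]
    -- In the even case, NE and SE lengthen the ordinate path from `u` to `u + 1` steps, while W
    -- leaves it at `u + 1`. In the odd case every abscissa factor is zero.
    rcases Int.emod_two_eq_zero_or_one ((n : ℤ) + (i + 1)) with h | h
    · obtain ⟨u, hu⟩ : ∃ u : ℕ, (n : ℤ) + (i + 1) = 2 * (u + 1) :=
        ⟨(((n : ℤ) + (i + 1)) / 2 - 1).toNat, by omega⟩
      rw [show (((n : ℤ) + (i - 1)) / 2).toNat = u by omega,
        show (((n : ℤ) + (i + 1)) / 2).toNat = u + 1 by omega,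
        show ((((n + 1 : ℕ) : ℤ) + i) / 2).toNat = u + 1 by push_cast; omega,
        ballotCount_succ n, ballotCount_succ u]
      ring
    · rw [ballotCount_eq_zero_of_odd h, ballotCount_eq_zero_of_odd (n := n) (j := i - 1) (by omega),
        ballotCount_eq_zero_of_odd (n := n + 1) (j := i) (by push_cast; omega)]
      ring

theorem walkCount_eq_zero_of_lt {n : ℕ} {i j : ℤ} (hi : 0 ≤ i) (hj : 0 ≤ j)
    (h : (n : ℤ) < i ∨ (n : ℤ) < j) : walkCount n i j = 0 := by
  rw [walkCount_eq n (by omega) (by omega)]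
  by_cases h' : (n : ℤ) < i
  · rw [ballotCount_eq_zero_of_lt h', zero_mul]
  · rw [ballotCount_eq_zero_of_lt (j := j) (by omega), mul_zero]

theorem coeff_completeGF (n i j : ℕ) :
    ((PowerSeries.coeff n completeGF).coeff j).coeff i = walkCount n i j := by
  have h : ∀ a b : ℕ, ((quadrantWalks stepsNESEW n a b).ncard : ℚ) = walkCount n a b :=
    fun _ _ => rfl
  simp only [completeGF, PowerSeries.coeff_mk, Polynomial.finsetSum_coeff, h,
    Polynomial.coeff_monomial]
  simp only [apply_ite (fun p : Polynomial ℚ => p.coeff i), Polynomial.coeff_monomial,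
    Polynomial.coeff_zero, Finset.sum_ite_eq', Finset.mem_range]
  by_cases h1 : j < n + 1 <;> by_cases h2 : i < n + 1 <;> simp [h1, h2]
  all_goals
    rw [walkCount_eq_zero_of_lt (by omega) (by omega) (by omega)]

theorem coeff_returnGF (n j : ℕ) :
    (PowerSeries.coeff n returnGF).coeff j = walkCount n 0 j := by
  rw [returnGF, PowerSeries.coeff_map, Polynomial.coe_mapRingHom, Polynomial.coeff_map,
    Polynomial.coe_evalRingHom, ← Polynomial.coeff_zero_eq_eval_zero, coeff_completeGF]
  simp

/-! ### Expansions in descending powers of `y` -/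

/-- The element `y⁻¹` of the field `ℚ((y⁻¹))`. -/
noncomputable def yInvElem : LaurentSeries ℚ := HahnSeries.single (1 : ℤ) (1 : ℚ)

theorem yElem_mul_yInvElem : yElem * yInvElem = 1 := by
  simp [yElem, yInvElem]

theorem coeff_yElem_mul (f : LaurentSeries ℚ) (a : ℤ) : (yElem * f).coeff a = f.coeff (a + 1) := by
  rw [yElem, HahnSeries.coeff_single_mul]
  simp

theorem coeff_yInvElem_mul (f : LaurentSeries ℚ) (a : ℤ) :
    (yInvElem * f).coeff a = f.coeff (a - 1) := by
  rw [yInvElem, HahnSeries.coeff_single_mul]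
  simp

theorem coeff_yElem_add_yInvElem_pow (n : ℕ) (j : ℤ) :
    ((yElem + yInvElem) ^ n).coeff (-j) = signCount n j := by
  induction n generalizing j with
  | zero =>
    simp only [pow_zero, signCount, HahnSeries.coeff_one, neg_eq_zero]
  | succ n ih =>
    rw [pow_succ', add_mul, HahnSeries.coeff_add, coeff_yElem_mul, coeff_yInvElem_mul, signCount,
      show -j + 1 = -(j - 1) by ring, show -j - 1 = -(j + 1) by ring, ih, ih]

theorem yElem_sq_add_one_ne_zero : yElem ^ 2 + 1 ≠ 0 := by
  intro h
  have h1 := congrArg (fun f : LaurentSeries ℚ => f.coeff 0) h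
  simp [yElem, pow_two] at h1

theorem ratio_mul_eq (m : ℕ) :
    (yElem ^ 2 - 1) / (yElem ^ 2 + 1) * (yElem + yInvElem) ^ (m + 1) =
      (yElem - yInvElem) * (yElem + yInvElem) ^ m := by
  rw [div_mul_eq_mul_div, div_eq_iff yElem_sq_add_one_ne_zero]
  linear_combination ((yElem + yInvElem) ^ m * (2 * yElem)) * yElem_mul_yInvElem

theorem coeff_ratio_mul (m : ℕ) (j : ℤ) :
    ((yElem ^ 2 - 1) / (yElem ^ 2 + 1) * (yElem + yInvElem) ^ (m + 1)).coeff (-j) =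
      ballotCount m (j - 1) := by
  rw [ratio_mul_eq, sub_mul, HahnSeries.coeff_sub, coeff_yElem_mul, coeff_yInvElem_mul,
    show -j + 1 = -(j - 1) by ring, show -j - 1 = -(j - 1 + 2) by ring,
    coeff_yElem_add_yInvElem_pow, coeff_yElem_add_yInvElem_pow, ballotCount]

/-- Divide numerator and denominator by `y²`: the denominator `1 + y⁻²` is invertible as a power
series in `y⁻¹`. -/
theorem ratio_eq_ofPowerSeries :
    ∃ u : PowerSeries ℚ, (yElem ^ 2 - 1) / (yElem ^ 2 + 1) = HahnSeries.ofPowerSeries ℤ ℚ u := by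
  refine ⟨(1 - PowerSeries.X ^ 2) * (1 + PowerSeries.X ^ 2)⁻¹, ?_⟩
  have h : (1 + PowerSeries.X ^ 2 : PowerSeries ℚ) * (1 + PowerSeries.X ^ 2)⁻¹ = 1 :=
    PowerSeries.mul_inv_cancel _ (by simp)
  have hX : HahnSeries.ofPowerSeries ℤ ℚ PowerSeries.X = yInvElem := HahnSeries.ofPowerSeries_X
  have h' := congrArg (HahnSeries.ofPowerSeries ℤ ℚ) h
  simp only [map_mul, map_add, map_one, map_pow, hX] at h'
  rw [div_eq_iff yElem_sq_add_one_ne_zero]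
  simp only [map_mul, map_sub, map_one, map_pow, hX]
  set v := HahnSeries.ofPowerSeries ℤ ℚ (1 + PowerSeries.X ^ 2)⁻¹
  have e := yElem_mul_yInvElem
  have h2 : yElem ^ 2 * yInvElem ^ 2 = 1 := by rw [← mul_pow, e, one_pow]
  linear_combination (1 - yElem ^ 2) * h' + 2 * v * h2

/-- Multiplying by `(y² - 1) / (y² + 1)` preserves the space of series in `y⁻¹` without
constant term. -/
theorem coeff_ratio_mul_ofPowerSeries_X_mul (g : PowerSeries ℚ) (j : ℕ) :
    ((yElem ^ 2 - 1) / (yElem ^ 2 + 1) *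
      HahnSeries.ofPowerSeries ℤ ℚ (PowerSeries.X * g)).coeff (-(j : ℤ)) = 0 := by
  obtain ⟨u, hu⟩ := ratio_eq_ofPowerSeries
  rw [hu, ← map_mul, mul_left_comm, map_mul, HahnSeries.ofPowerSeries_X,
    HahnSeries.coeff_single_mul, PowerSeries.coeff_coe, if_pos (by omega)]
  simp

theorem yElem_pow_mul_yInvElem_pow {n k : ℕ} (h : 2 * k ≤ n) :
    yElem ^ (n - k) * yInvElem ^ k = yElem ^ (n - 2 * k) := by
  rw [show n - k = n - 2 * k + k by omega, pow_add, mul_assoc, ← mul_pow, yElem_mul_yInvElem,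
    one_pow, mul_one]

theorem yElem_pow_mul_yInvElem_pow' {n k : ℕ} (h : n ≤ 2 * k) (hk : k ≤ n) :
    yElem ^ (n - k) * yInvElem ^ k = yInvElem ^ (2 * k - n) := by
  obtain ⟨d, rfl⟩ := Nat.exists_eq_add_of_le hk
  rw [show 2 * k - (k + d) = k - d by omega]
  obtain ⟨e, rfl⟩ := Nat.exists_eq_add_of_le (show d ≤ k by omega)
  rw [show d + e + d - (d + e) = d by omega, show d + e - d = e by omega, pow_add, ← mul_assoc,
    ← mul_pow, yElem_mul_yInvElem, one_pow, one_mul]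

/-- The binomial terms with `k > n / 2` have exponent `n - 2k < 0`; the factor `X` in the remainder
records that it has no constant term. -/
theorem yElem_add_yInvElem_pow_eq (n : ℕ) :
    ∃ g : PowerSeries ℚ, (yElem + yInvElem) ^ n =
      ∑ k ∈ Finset.range (n / 2 + 1), (n.choose k : LaurentSeries ℚ) * yElem ^ (n - 2 * k) +
        HahnSeries.ofPowerSeries ℤ ℚ (PowerSeries.X * g) := by
  refine ⟨∑ k ∈ Finset.Ico (n / 2 + 1) (n + 1),
    (n.choose k : PowerSeries ℚ) * PowerSeries.X ^ (2 * k - n - 1), ?_⟩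
  rw [add_comm, add_pow,
    ← Finset.sum_range_add_sum_Ico _ (show n / 2 + 1 ≤ n + 1 by omega), Finset.mul_sum, map_sum]
  congr 1
  · refine Finset.sum_congr rfl fun k hk => ?_
    have := Finset.mem_range.1 hk
    rw [← yElem_pow_mul_yInvElem_pow (show 2 * k ≤ n by omega)]
    ring
  · refine Finset.sum_congr rfl fun k hk => ?_
    have := Finset.mem_Ico.1 hk
    rw [mul_left_comm, ← pow_succ', show 2 * k - n - 1 + 1 = 2 * k - n by omega, map_mul,
      map_pow, map_natCast, HahnSeries.ofPowerSeries_X]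
    have h := yElem_pow_mul_yInvElem_pow' (show n ≤ 2 * k by omega) (show k ≤ n by omega)
    rw [show (HahnSeries.single (1 : ℤ) (1 : ℚ)) = yInvElem from rfl, ← h]
    ring

theorem coeff_quotientSeries_even {N : ℕ} (hN : Even N) :
    PowerSeries.coeff N quotientSeries = 0 := by
  rw [quotientSeries, PowerSeries.coeff_C_mul, PowerSeries.coeff_map, seriesS,
    PowerSeries.coeff_mk, if_neg (by simpa using hN), map_zero, mul_zero]

theorem aeval_coeff_seriesS (m : ℕ) :
    Polynomial.aeval (R := ℚ) yElem (PowerSeries.coeff (2 * m + 1) seriesS) =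
      algebraMap ℚ (LaurentSeries ℚ) (ballotCount (2 * m) 0) *
        ∑ k ∈ Finset.range ((m + 1) / 2 + 1),
          ((m + 1).choose k : LaurentSeries ℚ) * yElem ^ (m + 1 - 2 * k) := by
  rw [seriesS, PowerSeries.coeff_mk, if_pos ⟨m, rfl⟩, map_sum, Finset.mul_sum,
    show (2 * m + 1 + 1) / 2 = m + 1 by omega, ballotCount_two_mul_zero]
  refine Finset.sum_congr rfl fun k _ => ?_
  rw [Polynomial.aeval_monomial, show 2 * (m + 1) - 2 = 2 * m by omega,
    show m + 1 - 1 = m by omega, ← map_natCast (algebraMap ℚ (LaurentSeries ℚ)) ((m + 1).choose k),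
    ← mul_assoc, ← map_mul]
  congr 2
  ring

theorem coeff_quotientSeries_odd (m j : ℕ) :
    (PowerSeries.coeff (2 * m + 1) quotientSeries).coeff (-(j : ℤ)) =
      ballotCount (2 * m) 0 * ballotCount m (j - 1) := by
  obtain ⟨g, hg⟩ := yElem_add_yInvElem_pow_eq (m + 1)
  rw [quotientSeries, PowerSeries.coeff_C_mul, PowerSeries.coeff_map]
  have h : (Polynomial.aeval (R := ℚ) yElem).toRingHom (PowerSeries.coeff (2 * m + 1) seriesS) =
    _ := aeval_coeff_seriesS m
  -- The polynomial part is written as the full power minus its tail, and the tail does not reach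
  -- the exponent `-j`.
  rw [h, eq_sub_iff_add_eq.2 hg.symm, mul_left_comm,
    show algebraMap ℚ (LaurentSeries ℚ) = HahnSeries.C from Subsingleton.elim _ _,
    HahnSeries.C_apply, HahnSeries.coeff_single_mul, sub_zero,
    mul_sub, HahnSeries.coeff_sub, coeff_ratio_mul_ofPowerSeries_X_mul, sub_zero,
    coeff_ratio_mul]

theorem coeff_X_mul_C_X_mul_returnGF (N j : ℕ) :
    (PowerSeries.coeff N
        (PowerSeries.X * PowerSeries.C (Polynomial.X : Polynomial ℚ) * returnGF)).coeff j =
      (PowerSeries.coeff N quotientSeries).coeff (-(j : ℤ)) := by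
  rw [mul_assoc]
  rcases Nat.even_or_odd' N with ⟨m, rfl | rfl⟩
  · rw [coeff_quotientSeries_even (by simp)]
    rcases m with _ | m
    · simp
    rw [show 2 * (m + 1) = 2 * m + 1 + 1 by ring, PowerSeries.coeff_succ_X_mul,
      PowerSeries.coeff_C_mul]
    rcases j with _ | j
    · simp
    rw [Polynomial.coeff_X_mul, coeff_returnGF, walkCount_eq _ (by omega) (by omega),
      ballotCount_eq_zero_of_odd (by push_cast; omega)]
    simp
  · rw [coeff_quotientSeries_odd, PowerSeries.coeff_succ_X_mul, PowerSeries.coeff_C_mul]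
    rcases j with _ | j
    · simp [ballotCount_neg_one]
    rw [Polynomial.coeff_X_mul, coeff_returnGF, walkCount_eq _ (by omega) (by omega),
      show ((((2 * m : ℕ) : ℤ) + 0) / 2).toNat = m by push_cast; omega]
    simp

/-! ### The kernel root `T` -/

/-- The kernel equation satisfied by `T`. -/
theorem IsKernelRoot.kernel_eq {U : PowerSeries ℚ[T;T⁻¹]} (h : IsKernelRoot U) :
    (PowerSeries.C (LaurentPolynomial.T 1) - PowerSeries.X) * U =
      PowerSeries.X * PowerSeries.C (LaurentPolynomial.T 1) ^ 2 * (U ^ 2 + 1) := by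
  obtain ⟨D, -, h1, h2⟩ := h
  set x : PowerSeries ℚ[T;T⁻¹] := PowerSeries.C (LaurentPolynomial.T 1) with hx
  set t : PowerSeries ℚ[T;T⁻¹] := PowerSeries.X with ht
  have hx0 : x ≠ 0 := by
    rw [hx, Ne, map_eq_zero_iff _ PowerSeries.C_injective]
    exact (LaurentPolynomial.isUnit_T 1).ne_zero
  have ht0 : t ≠ 0 := PowerSeries.X_ne_zero
  have h4 : (4 : PowerSeries ℚ[T;T⁻¹]) ≠ 0 := by
    intro h
    have := congrArg (PowerSeries.constantCoeff) h
    simp only [map_ofNat, map_zero] at this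
    have := congrArg (LaurentPolynomial.eval₂ (RingHom.id ℚ) 1) this
    rw [map_ofNat, map_zero] at this
    norm_num at this
  have hD : D = (x - t) - 2 * t * x ^ 2 * U := by rw [h2]; ring
  refine mul_left_cancel₀ (mul_ne_zero (mul_ne_zero h4 ht0) (pow_ne_zero 2 hx0)) ?_
  rw [hD] at h1
  linear_combination -h1

theorem isKernelRoot_of_kernel_eq {U : PowerSeries ℚ[T;T⁻¹]}
    (h : (PowerSeries.C (LaurentPolynomial.T 1) - PowerSeries.X) * U =
      PowerSeries.X * PowerSeries.C (LaurentPolynomial.T 1) ^ 2 * (U ^ 2 + 1)) :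
    IsKernelRoot U := by
  refine ⟨(PowerSeries.C (LaurentPolynomial.T 1) - PowerSeries.X) -
    2 * PowerSeries.X * PowerSeries.C (LaurentPolynomial.T 1) ^ 2 * U, by simp, ?_, by ring⟩
  linear_combination
    -4 * PowerSeries.X * PowerSeries.C (LaurentPolynomial.T 1) ^ 2 * h

/-- The difference of the two kernel equations factors, and the cofactor of `U - V` has constant
term `x ≠ 0`. -/
theorem IsKernelRoot.unique {U V : PowerSeries ℚ[T;T⁻¹]} (hU : IsKernelRoot U)
    (hV : IsKernelRoot V) : U = V := by
  have h1 := hU.kernel_eq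
  have h2 := hV.kernel_eq
  have h : (U - V) * (PowerSeries.C (LaurentPolynomial.T 1) - PowerSeries.X -
      PowerSeries.X * PowerSeries.C (LaurentPolynomial.T 1) ^ 2 * (U + V)) = 0 := by
    linear_combination h1 - h2
  rcases mul_eq_zero.1 h with h | h
  · exact sub_eq_zero.1 h
  · have := congrArg PowerSeries.constantCoeff h
    simp at this
    exact absurd this (LaurentPolynomial.isUnit_T 1).ne_zero

/-- The Catalan series gives a root of `U = w (1 + U²)` for every series `w` without constant
term. -/
theorem exists_eq_mul_sq_add_one {A : Type*} [CommRing A] (w : PowerSeries A)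
    (hw : PowerSeries.constantCoeff w = 0) : ∃ U : PowerSeries A, U = w * (U ^ 2 + 1) := by
  have hs : PowerSeries.HasSubst (w ^ 2) :=
    PowerSeries.HasSubst.of_constantCoeff_zero' (by simp [hw])
  set c : PowerSeries A := PowerSeries.map (Nat.castRingHom A) PowerSeries.catalanSeries
  have hc : c ^ 2 * PowerSeries.X + 1 = c := by
    have := congrArg (PowerSeries.map (Nat.castRingHom A))
      PowerSeries.catalanSeries_sq_mul_X_add_one
    simpa using this
  have h := congrArg (PowerSeries.substAlgHom (R := A) hs) hc
  rw [map_add, map_mul, map_pow, map_one, PowerSeries.substAlgHom_X] at h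
  refine ⟨w * PowerSeries.substAlgHom (R := A) hs c, ?_⟩
  linear_combination -w * h

theorem exists_isKernelRoot : ∃ U, IsKernelRoot U := by
  have hx : (LaurentPolynomial.T 1 : ℚ[T;T⁻¹]) * LaurentPolynomial.T (-1) = 1 := by
    rw [← LaurentPolynomial.T_add]; simp
  obtain ⟨v, hv⟩ : IsUnit
      (PowerSeries.C (LaurentPolynomial.T 1) - PowerSeries.X : PowerSeries ℚ[T;T⁻¹]) := by
    rw [PowerSeries.isUnit_iff_constantCoeff]
    simpa using LaurentPolynomial.isUnit_T 1
  -- The kernel equation reads `U = w (U² + 1)` with `w = t x² / (x - t)`; here `x - t` is a unit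
  -- because `x` is one.
  obtain ⟨U, hU⟩ := exists_eq_mul_sq_add_one
    (PowerSeries.X * PowerSeries.C (LaurentPolynomial.T 1) ^ 2 *
      ((v⁻¹ : (PowerSeries ℚ[T;T⁻¹])ˣ) : PowerSeries ℚ[T;T⁻¹])) (by simp)
  refine ⟨U, isKernelRoot_of_kernel_eq ?_⟩
  have hv' := v.mul_inv
  rw [← hv]
  linear_combination (v : PowerSeries ℚ[T;T⁻¹]) * hU +
    PowerSeries.X * PowerSeries.C (LaurentPolynomial.T 1) ^ 2 * (U ^ 2 + 1) * hv'

/-! ### The functional equation -/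

/-- The series `Q(x, 0; t)`. -/
noncomputable def axisGF : PowerSeries (Polynomial ℚ) :=
  PowerSeries.map (Polynomial.evalRingHom (0 : Polynomial ℚ)) completeGF

theorem coeff_axisGF (n i : ℕ) : (PowerSeries.coeff n axisGF).coeff i = walkCount n i 0 := by
  rw [axisGF, PowerSeries.coeff_map, Polynomial.coe_evalRingHom,
    ← Polynomial.coeff_zero_eq_eval_zero, coeff_completeGF]
  simp

/-- The functional equation obtained by removing the last step of a walk. -/
theorem completeGF_functional_equation :
    let x : PowerSeries (Polynomial (Polynomial ℚ)) := PowerSeries.C (Polynomial.C Polynomial.X)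
    let y : PowerSeries (Polynomial (Polynomial ℚ)) := PowerSeries.C Polynomial.X
    let t : PowerSeries (Polynomial (Polynomial ℚ)) := PowerSeries.X
    x * y * completeGF = x * y + t * (x ^ 2 * (y ^ 2 + 1) + y) * completeGF
      - t * x ^ 2 * PowerSeries.map Polynomial.C axisGF
      - t * y * PowerSeries.map (Polynomial.mapRingHom Polynomial.C) returnGF := by
  intro x y t
  -- Constants in `t` are gathered under `C` and `t` is factored out, so that coefficients can be
  -- read off termwise.
  have e : x * y + t * (x ^ 2 * (y ^ 2 + 1) + y) * completeGF
      - t * x ^ 2 * PowerSeries.map Polynomial.C axisGF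
      - t * y * PowerSeries.map (Polynomial.mapRingHom Polynomial.C) returnGF =
      PowerSeries.C (Polynomial.X * Polynomial.C Polynomial.X) + PowerSeries.X *
      (PowerSeries.C (Polynomial.C (Polynomial.X ^ 2) * Polynomial.X ^ 2) * completeGF
      + PowerSeries.C (Polynomial.C (Polynomial.X ^ 2)) * completeGF
      + PowerSeries.C Polynomial.X * completeGF
      - PowerSeries.C (Polynomial.C (Polynomial.X ^ 2)) * PowerSeries.map Polynomial.C axisGF
      - PowerSeries.C Polynomial.X *
        PowerSeries.map (Polynomial.mapRingHom Polynomial.C) returnGF) := by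
    simp only [x, y, t, map_mul, map_pow]
    ring
  have e' : x * y * completeGF =
      PowerSeries.C (Polynomial.X * Polynomial.C Polynomial.X) * completeGF := by
    simp only [x, y, map_mul]
    ring
  rw [e, e']
  ext n j i
  rcases n with _ | n
  · simp only [PowerSeries.coeff_C_mul, map_add, PowerSeries.coeff_zero_X_mul, add_zero,
      PowerSeries.coeff_zero_C]
    rcases j with _ | j
    · simp [mul_assoc]
    rcases i with _ | i
    · simp [mul_assoc, Polynomial.coeff_C, apply_ite (fun p : Polynomial ℚ => p.coeff 0)]
    rw [mul_assoc, Polynomial.coeff_X_mul, Polynomial.coeff_C_mul, Polynomial.coeff_X_mul,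
      coeff_completeGF, Polynomial.coeff_X_mul, walkCount_zero, Polynomial.coeff_C]
    split_ifs with h1 h2 h2 <;> simp [Polynomial.coeff_X] <;> omega
  · simp only [PowerSeries.coeff_C_mul, map_add, map_sub, PowerSeries.coeff_succ_X_mul,
      PowerSeries.coeff_succ_C, zero_add, PowerSeries.coeff_map, Polynomial.coeff_add,
      Polynomial.coeff_sub, mul_assoc, Polynomial.coeff_C_mul, Polynomial.coe_mapRingHom]
    rcases j with _ | j
    · simp [coeff_completeGF, coeff_axisGF, Polynomial.coeff_X_pow_mul']
    rw [Polynomial.coeff_X_mul, Polynomial.coeff_X_mul, Polynomial.coeff_X_mul]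
    rcases j with _ | _ | j <;> rcases i with _ | _ | i <;>
    simp [coeff_completeGF, coeff_returnGF, Polynomial.coeff_X_pow_mul',
      Polynomial.coeff_C]
    all_goals rw [walkCount_succ _ (by positivity) (by positivity)]
    all_goals simp [walkCount_eq_zero]

/-! ### Substituting a series in `t` for `y` -/

section Substitution

variable {A : Type*} [CommRing A]

/-- Substitution `F(U, t)` of `y = U(t)` in `F(y, t) = ∑ fₘ(y) tᵐ`. -/
noncomputable def evalY (U : PowerSeries A) (F : PowerSeries (Polynomial A)) : PowerSeries A :=
  PowerSeries.mk fun N =>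
    ∑ m ∈ Finset.range (N + 1),
      PowerSeries.coeff (N - m) (Polynomial.aeval U (PowerSeries.coeff m F))

/-- Each coefficient depends on a finite partial sum, so the substitution rules reduce to finite
algebra. -/
theorem coeff_evalY_of_lt (U : PowerSeries A) (F : PowerSeries (Polynomial A)) {N M : ℕ}
    (h : N < M) :
    PowerSeries.coeff N (evalY U F) = PowerSeries.coeff N
      (∑ m ∈ Finset.range M, PowerSeries.X ^ m * Polynomial.aeval U (PowerSeries.coeff m F)) := by
  rw [evalY, PowerSeries.coeff_mk, map_sum,
    ← Finset.sum_subset (Finset.range_subset_range.2 (Nat.succ_le_of_lt h))]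
  · refine Finset.sum_congr rfl fun m hm => ?_
    rw [PowerSeries.coeff_X_pow_mul', if_pos (Nat.lt_succ_iff.1 (Finset.mem_range.1 hm))]
  · intro m _ hm
    rw [PowerSeries.coeff_X_pow_mul', if_neg]
    simpa using hm

theorem evalY_add (U : PowerSeries A) (F G : PowerSeries (Polynomial A)) :
    evalY U (F + G) = evalY U F + evalY U G := by
  ext N
  simp [evalY, Finset.sum_add_distrib]

theorem evalY_C_mul (U : PowerSeries A) (p : Polynomial A) (F : PowerSeries (Polynomial A)) :
    evalY U (PowerSeries.C p * F) = Polynomial.aeval U p * evalY U F := by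
  ext N
  rw [coeff_evalY_of_lt U _ N.lt_succ_self, PowerSeries.coeff_mul]
  have h : ∀ q ∈ Finset.HasAntidiagonal.antidiagonal N,
      PowerSeries.coeff q.1 (Polynomial.aeval U p) * PowerSeries.coeff q.2 (evalY U F) =
      PowerSeries.coeff q.1 (Polynomial.aeval U p) * PowerSeries.coeff q.2
        (∑ m ∈ Finset.range (N + 1),
          PowerSeries.X ^ m * Polynomial.aeval U (PowerSeries.coeff m F)) := by
    intro q hq
    have := Finset.HasAntidiagonal.mem_antidiagonal.1 hq
    rw [coeff_evalY_of_lt U F (show q.2 < N + 1 by omega)]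
  rw [Finset.sum_congr rfl h, ← PowerSeries.coeff_mul, Finset.mul_sum]
  congr 1
  refine Finset.sum_congr rfl fun m _ => ?_
  rw [PowerSeries.coeff_C_mul, map_mul]
  ring

theorem evalY_X_mul (U : PowerSeries A) (F : PowerSeries (Polynomial A)) :
    evalY U (PowerSeries.X * F) = PowerSeries.X * evalY U F := by
  ext N
  rcases N with _ | N
  · simp [evalY]
  · rw [PowerSeries.coeff_succ_X_mul, evalY, evalY, PowerSeries.coeff_mk, PowerSeries.coeff_mk,
      Finset.sum_range_succ']
    simp [PowerSeries.coeff_succ_X_mul]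

theorem evalY_map_C (U G : PowerSeries A) : evalY U (PowerSeries.map Polynomial.C G) = G := by
  ext N
  rw [evalY, PowerSeries.coeff_mk, Finset.sum_eq_single N]
  · simp
  · intro m hm hne
    have := Finset.mem_range.1 hm
    rw [PowerSeries.coeff_map, Polynomial.aeval_C, PowerSeries.algebraMap_apply,
      PowerSeries.coeff_C, if_neg (by omega)]
  · simp

theorem evalY_C (U : PowerSeries A) (p : Polynomial A) :
    evalY U (PowerSeries.C p) = Polynomial.aeval U p := by
  have h : evalY U 1 = 1 := by simpa using evalY_map_C U 1
  rw [← mul_one (PowerSeries.C p), evalY_C_mul, h, mul_one]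

end Substitution

/-! ### The kernel method -/

theorem evalY_inclX (U G : PowerSeries ℚ[T;T⁻¹]) : evalY U (inclX G) = G :=
  evalY_map_C U G

theorem evalY_inclY (U : PowerSeries ℚ[T;T⁻¹]) (F : PowerSeries (Polynomial ℚ)) :
    evalY U (inclY F) = substY F U := by
  ext N
  simp only [evalY, substY, inclY, PowerSeries.coeff_mk, PowerSeries.coeff_map,
    Polynomial.coe_mapRingHom, Polynomial.aeval_map_algebraMap]

theorem inclXY_functional_equation :
    let x : PowerSeries (Polynomial ℚ[T;T⁻¹]) :=
      PowerSeries.C (Polynomial.C (LaurentPolynomial.T 1))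
    let y : PowerSeries (Polynomial ℚ[T;T⁻¹]) := PowerSeries.C Polynomial.X
    let t : PowerSeries (Polynomial ℚ[T;T⁻¹]) := PowerSeries.X
    x * y * inclXY completeGF = x * y + t * (x ^ 2 * (y ^ 2 + 1) + y) * inclXY completeGF
      - t * x ^ 2 * inclX (PowerSeries.map Polynomial.toLaurent axisGF)
      - t * y * inclY returnGF := by
  intro x y t
  have h := congrArg inclXY completeGF_functional_equation
  have hx : inclXY (PowerSeries.C (Polynomial.C Polynomial.X)) = x := by
    simp [inclXY, x]
  have hy : inclXY (PowerSeries.C Polynomial.X) = y := by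
    simp [inclXY, y]
  have ht : inclXY PowerSeries.X = t := by
    simp [inclXY, t]
  have hA : inclXY (PowerSeries.map Polynomial.C axisGF) =
      inclX (PowerSeries.map Polynomial.toLaurent axisGF) := by
    ext1 n
    simp [inclXY, inclX]
  have hR : inclXY (PowerSeries.map (Polynomial.mapRingHom Polynomial.C) returnGF) =
      inclY returnGF := by
    ext n j
    simp [inclXY, inclY]
  simpa only [map_sub, map_add, map_mul, map_pow, map_one, hx, hy, ht, hA, hR] using h

/-- The kernel method: setting `y = T` in the functional equation. -/
theorem IsKernelRoot.axisGF_eq {U : PowerSeries ℚ[T;T⁻¹]} (hU : IsKernelRoot U) :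
    U * (PowerSeries.C (LaurentPolynomial.T 1) - PowerSeries.X * substY returnGF U) =
      PowerSeries.X * PowerSeries.C (LaurentPolynomial.T 1) ^ 2 *
        PowerSeries.map Polynomial.toLaurent axisGF := by
  have h := inclXY_functional_equation
  set X : Polynomial ℚ[T;T⁻¹] := Polynomial.C (LaurentPolynomial.T 1) with hX
  set Y : Polynomial ℚ[T;T⁻¹] := Polynomial.X with hY
  have h' : PowerSeries.C (X * Y) * inclXY completeGF +
      PowerSeries.X * (PowerSeries.C (X ^ 2) *
        inclX (PowerSeries.map Polynomial.toLaurent axisGF)) +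
      PowerSeries.X * (PowerSeries.C Y * inclY returnGF) =
      PowerSeries.C (X * Y) +
        PowerSeries.X * (PowerSeries.C (X ^ 2 * (Y ^ 2 + 1) + Y) * inclXY completeGF) := by
    simp only [map_add, map_mul, map_pow, map_one]
    linear_combination h
  have h2 := congrArg (evalY U) h'
  simp only [evalY_add, evalY_X_mul, evalY_C_mul, evalY_C, evalY_inclX, evalY_inclY] at h2
  simp only [hX, hY, map_add, map_mul, map_pow, map_one, Polynomial.aeval_C, Polynomial.aeval_X,
    PowerSeries.algebraMap_apply, Algebra.algebraMap_self, RingHom.id_apply] at h2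
  -- The kernel equation, multiplied by `Q(x, T; t)`, cancels every occurrence of that unknown.
  linear_combination -h2 + evalY U (inclXY completeGF) * hU.kernel_eq

theorem kernel_ne_zero :
    (PowerSeries.C (Polynomial.C (LaurentPolynomial.T 1)) * PowerSeries.C Polynomial.X -
      PowerSeries.X * PowerSeries.C (Polynomial.C (LaurentPolynomial.T 1)) ^ 2 *
        (PowerSeries.C Polynomial.X ^ 2 + 1) - PowerSeries.X * PowerSeries.C Polynomial.X :
      PowerSeries (Polynomial ℚ[T;T⁻¹])) ≠ 0 := by
  intro h
  have h1 := congrArg PowerSeries.constantCoeff h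
  simp only [map_sub, map_mul, PowerSeries.constantCoeff_C, PowerSeries.constantCoeff_X, zero_mul,
    sub_zero, map_zero] at h1
  have h2 := congrArg (fun p => p.coeff 1) h1
  simp at h2
  exact (LaurentPolynomial.isUnit_T 1).ne_zero h2

theorem mainTheorem6 :
    -- `t * y * R(y, t)` is the part of `(y² - 1) S(y, t) / (y² + 1)` with non-negative powers of `y`
    (∀ N j : ℕ,
      (PowerSeries.coeff N
          (PowerSeries.X * PowerSeries.C (Polynomial.X : Polynomial ℚ) * returnGF)).coeff j =
        (PowerSeries.coeff N quotientSeries).coeff (-(j : ℤ))) ∧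
    -- `T` is a well-defined series
    (∃! T : PowerSeries ℚ[T;T⁻¹], IsKernelRoot T) ∧
    -- the closed form of `Q(x, y; t)`, as an identity in the domain `ℚ[x, x⁻¹][y]⟦t⟧`
    (∀ T : PowerSeries ℚ[T;T⁻¹], IsKernelRoot T →
      let x : PowerSeries (Polynomial ℚ[T;T⁻¹]) :=
        PowerSeries.C (Polynomial.C (LaurentPolynomial.T 1))
      let y : PowerSeries (Polynomial ℚ[T;T⁻¹]) := PowerSeries.C Polynomial.X
      let t : PowerSeries (Polynomial ℚ[T;T⁻¹]) := PowerSeries.X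
      x * y - t * x ^ 2 * (y ^ 2 + 1) - t * y ≠ 0 ∧
      (x * y - t * x ^ 2 * (y ^ 2 + 1) - t * y) * inclXY completeGF =
        x * y - inclX T * (x - t * inclX (substY returnGF T)) - t * y * inclY returnGF) := by

  refine ⟨coeff_X_mul_C_X_mul_returnGF, ?_, ?_⟩
  · obtain ⟨U, hU⟩ := exists_isKernelRoot
    exact ⟨U, hU, fun V hV => hV.unique hU⟩
  · intro U hU x y t
    refine ⟨kernel_ne_zero, ?_⟩
    have h := inclXY_functional_equation
    have h2 := congrArg inclX hU.axisGF_eq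
    have hx : inclX (PowerSeries.C (LaurentPolynomial.T 1)) = x := by simp [inclX, x]
    have ht : inclX PowerSeries.X = t := by simp [inclX, t]
    simp only [map_sub, map_mul, map_pow, hx, ht] at h2
    -- Adding the two identities eliminates `Q(x, 0; t)`.
    linear_combination h + h2
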